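/- Let $(R,\mathfrak m)$ be a Noetherian local ring of dimension $2$ and let $J=(x,y)$ be a parameter ideal, i.e. $\sqrt{(x,y)}=\mathfrak m$. Let $\mathcal J=\{J_n\}_{n\in\mathbb Z}$ be a $J$-admissible filtration: a family of ideals such that $J_{n+1}\subseteq J_n$ and $J_mJ_n\subseteq J_{m+n}$ for all $m,n\in\mathbb Z$, and such that for some $k\in\mathbb N$ we have $J^n\subseteq J_n\subseteq J^{n-k}$ for all $n\in\mathbb Z$ (where $J^m=R$ for $m\le 0$). Let $G(\mathcal J)=\bigoplus_{n\ge 0}J_n/J_{n+1}$ be its associated graded ring, and suppose that the image $x^*\in J_1/J_2$ of $x$ is a nonzerodivisor in $G(\mathcal J)$ (in particular $\operatorname{depth}G(\mathcal J)\ge 1$). Write $\lambda$ for length over $R$ and $(x:y)=\{r\in R: ry\in (x)\}$. Then there are (unique) integers $e_0(\mathcal J),e_1(\mathcal J),e_2(\mathcal J)$, the Hilbert coefficients of $\mathcal J$, such that for all large $n$ $$\lambda(R/J_n)=e_0(\mathcal J)\binom{n+1}{2}-e_1(\mathcal J)\,n+e_2(\mathcal J).$$ Moreover, for every $n\ge 1$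 the lengths below are finite, only finitely many terms of the sum are nonzero, and $$e_1(\mathcal J)=\sum_{n\ge 1}\left[\lambda\!\left(\frac{J_n}{J J_{n-1}}\right)-\lambda\!\left(\frac{(x:y)\cap J_{n-1}}{(x)J_{n-2}}\right)\right].$$ -/

import Mathlib

open Polynomial Filter

/-- An `I`-admissible filtration of a commutative ring `R`: a family of ideals `(I_n)`, `n ∈ ℤ`, with
`I_{n+1} ⊆ I_n`, `I_m I_n ⊆ I_{m+n}`, and such that for some `k ∈ ℕ` one has
`I ^ n ⊆ I_n ⊆ I ^ (n - k)` for all `n ∈ ℤ`, where `I ^ m = R` for `m ≤ 0`. -/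
structure AdmissibleFiltration {R : Type*} [CommRing R] (I : Ideal R) where
  /-- The `n`-th ideal of the filtration. -/
  obj : ℤ → Ideal R
  succ_le : ∀ n : ℤ, obj (n + 1) ≤ obj n
  mul_le : ∀ m n : ℤ, obj m * obj n ≤ obj (m + n)
  admissible : ∃ k : ℕ, ∀ n : ℤ, I ^ n.toNat ≤ obj n ∧ obj n ≤ I ^ (n - k).toNat

namespace AdmissibleFiltration

variable {R : Type*} [CommRing R] {I : Ideal R}

theorem obj_zero (F : AdmissibleFiltration I) : F.obj 0 = ⊤ := by
  obtain ⟨k, hk⟩ := F.admissible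
  have h := (hk 0).1
  simpa using h

theorem le_obj_one (F : AdmissibleFiltration I) : I ≤ F.obj 1 := by
  obtain ⟨k, hk⟩ := F.admissible
  have h := (hk 1).1
  simpa using h

/-- The (nonnegative part of the) Rees algebra `⊕_{n ≥ 0} I_n t^n`, as a subalgebra of `R[t]`. -/
def rees (F : AdmissibleFiltration I) : Subalgebra R R[X] where
  carrier := { f | ∀ n : ℕ, f.coeff n ∈ F.obj n }
  mul_mem' {f g} hf hg n := by
    rw [coeff_mul]
    refine Ideal.sum_mem _ fun p hp => ?_
    have h := F.mul_le p.1 p.2 (Ideal.mul_mem_mul (hf p.1) (hg p.2))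
    have e : p.1 + p.2 = n := by simpa using hp
    rwa [← Nat.cast_add, e] at h
  add_mem' {f g} hf hg n := by
    rw [coeff_add]
    exact Ideal.add_mem _ (hf n) (hg n)
  algebraMap_mem' r n := by
    rw [Polynomial.algebraMap_apply, coeff_C]
    split_ifs with h
    · subst h
      simp [F.obj_zero]
    · exact Ideal.zero_mem _

theorem monomial_mem_rees (F : AdmissibleFiltration I) (n : ℕ) (a : F.obj n) :
    monomial n (a : R) ∈ F.rees := by
  intro m
  rw [coeff_monomial]
  split_ifs with h
  · subst h
    exact a.2
  · exact Ideal.zero_mem _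

/-- The ideal `⊕_{n ≥ 0} I_{n+1} t^n` of the Rees algebra `⊕_{n ≥ 0} I_n t^n`. -/
def reesShift (F : AdmissibleFiltration I) : Ideal F.rees where
  carrier := { f | ∀ n : ℕ, (f : R[X]).coeff n ∈ F.obj (n + 1) }
  add_mem' {f g} hf hg n := by
    rw [Subalgebra.coe_add, coeff_add]
    exact Ideal.add_mem _ (hf n) (hg n)
  zero_mem' n := by simp
  smul_mem' c f hf n := by
    rw [smul_eq_mul, Subalgebra.coe_mul, coeff_mul]
    refine Ideal.sum_mem _ fun p hp => ?_
    have h := F.mul_le p.1 (p.2 + 1) (Ideal.mul_mem_mul (c.2 p.1) (hf p.2))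
    have e : p.1 + p.2 = n := by simpa using hp
    rwa [← add_assoc, ← Nat.cast_add, e] at h

/-- The associated graded ring `G = ⊕_{n ≥ 0} I_n / I_{n+1}` of the filtration, constructed as
the quotient `(⊕_{n ≥ 0} I_n t^n) / (⊕_{n ≥ 0} I_{n+1} t^n)`. -/
def assocGraded (F : AdmissibleFiltration I) : Type _ :=
  F.rees ⧸ F.reesShift

noncomputable instance (F : AdmissibleFiltration I) : CommRing F.assocGraded :=
  inferInstanceAs (CommRing (F.rees ⧸ F.reesShift))

/-- The quotient map `⊕_{n ≥ 0} I_n t^n → G`. -/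
noncomputable def reesToGraded (F : AdmissibleFiltration I) : F.rees →+* F.assocGraded :=
  Ideal.Quotient.mk F.reesShift

theorem reesToGraded_eq_zero_iff (F : AdmissibleFiltration I) (f : F.rees) :
    F.reesToGraded f = 0 ↔ ∀ n : ℕ, (f : R[X]).coeff n ∈ F.obj (n + 1) :=
  Ideal.Quotient.eq_zero_iff_mem (I := F.reesShift)

/-- The class in `I_n / I_{n+1} ⊆ G`, homogeneous of degree `n`, of an element `a ∈ I_n`. -/
noncomputable def gradedClass (F : AdmissibleFiltration I) (n : ℕ) (a : F.obj n) :
    F.assocGraded :=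
  F.reesToGraded ⟨monomial n (a : R), F.monomial_mem_rees n a⟩

/-- The Hilbert function `n ↦ λ(R / I_n)` of the filtration. -/
noncomputable def hilbertFunction (F : AdmissibleFiltration I) (n : ℤ) : ℕ∞ :=
  Module.length R (R ⧸ F.obj n)

/-- The integers `e_0, …, e_d` are the Hilbert coefficients of the filtration (in dimension `d`):
for all large `n`, the length `λ(R / I_n)` is finite and equals
`∑_{i=0}^{d} (-1)^i e_i * binom(n + d - 1 - i, d - i)`. -/
def IsHilbertCoeffs (F : AdmissibleFiltration I) (d : ℕ) (e : Fin (d + 1) → ℤ) : Prop :=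
  ∀ᶠ n : ℤ in atTop, ∃ l : ℕ, F.hilbertFunction n = l ∧
    (l : ℤ) = ∑ i : Fin (d + 1),
      (-1) ^ (i : ℕ) * e i * Ring.choose (n + d - 1 - (i : ℕ)) (d - (i : ℕ))

open Classical in
/-- The Hilbert coefficients `e_0, …, e_d` of the filtration in dimension `d` (with the value `0`
if there are none). -/
noncomputable def hilbertCoeffs (F : AdmissibleFiltration I) (d : ℕ) : Fin (d + 1) → ℤ :=
  if h : ∃ e, F.IsHilbertCoeffs d e then h.choose else 0

end AdmissibleFiltration

/-- The length `λ(M / N)` over `R` of the quotient of ideals `N ⊆ M`. -/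
noncomputable def quotLength {R : Type*} [CommRing R] (M N : Ideal R) : ℕ∞ :=
  Module.length R (M ⧸ N.submoduleOf M)

/-!
Write `H(n) = λ(R / J_n)`. Regularity of `x*` gives `(J_{n+1} : x) = J_n`
(`AdmissibleFiltration.mem_obj_of_mul_mem`) and, by Krull's intersection theorem, regularity of `x`.
The Koszul map `(a, b) ↦ x a + y b` sends `(R / J_{n-1})²` onto `J / J J_{n-1}`; as `x` is regular,
its kernel is isomorphic to `(x : y) / ((x : y) ∩ J_{n-1})` through the second coordinate
(`AdmissibleFiltration.relLength_top_add_self`). Comparing lengths along `J J_{n-1} ⊆ J_n ⊆ R`,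
`J J_{n-1} ⊆ J ⊆ R`, `x J_{n-2} ⊆ (x) ⊆ (x : y)` and
`x J_{n-2} ⊆ (x : y) ∩ J_{n-1} ⊆ (x : y)`, with `(x) / x J_{n-2} ≅ R / J_{n-2}`, yields
`λ(J_n / J J_{n-1}) - λ(((x : y) ∩ J_{n-1}) / x J_{n-2}) = E - (H(n) - 2 H(n-1) + H(n-2))`
with `E = λ(R / J) - λ((x : y) / (x))` (`AdmissibleFiltration.exists_huneke_identity`).

The left side vanishes for large `n` (`AdmissibleFiltration.exists_quotLength_eq_zero`): the Rees
module of the filtration is finitely generated over the Rees algebra of `J`, whence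
`J_n = J J_{n-1}`, and Artin–Rees gives `(x : y) ∩ J_{n-1} ⊆ J (x : y) ⊆ (x)`. Thus the second
difference of `H` is eventually the constant `E`, so `H` is eventually a quadratic polynomial with
leading coefficient `E`; since `H(n) = 0` for `n ≤ 0`, summing the identity telescopes to
`E n - (H(n) - H(n-1))`, which is `e_1` for large `n`.
-/

/-! ### Lengths of subquotients -/

section RelativeLength

variable {R E E' : Type*} [CommRing R] [AddCommGroup E] [Module R E]
  [AddCommGroup E'] [Module R E']

/-- The length of `A / (A ∩ B)` for submodules `A`, `B` of a module; it is only used for `B ≤ A`.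
For ideals of `R` it is definitionally `quotLength A B`. -/
noncomputable def relLength (A B : Submodule R E) : ℕ∞ :=
  Module.length R (A ⧸ B.submoduleOf A)

theorem relLength_add {A B C : Submodule R E} (hBA : B ≤ A) (hCB : C ≤ B) :
    relLength A B + relLength B C = relLength A C := by
  have hi : C.submoduleOf B ≤ (C.submoduleOf A).comap (Submodule.inclusion hBA) :=
    fun z hz => hz
  have hg : C.submoduleOf A ≤ (B.submoduleOf A).comap LinearMap.id := fun z hz => hCB hz
  rw [add_comm]
  refine (Module.length_eq_add_of_exact (Submodule.mapQ _ _ _ hi) (Submodule.mapQ _ _ _ hg)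
    ?_ ?_ ?_).symm
  · rw [injective_iff_map_eq_zero]
    intro z
    obtain ⟨z, rfl⟩ := Submodule.Quotient.mk_surjective _ z
    intro hz
    rw [Submodule.mapQ_apply, Submodule.Quotient.mk_eq_zero] at hz
    rw [Submodule.Quotient.mk_eq_zero]
    exact hz
  · intro z
    obtain ⟨z, rfl⟩ := Submodule.Quotient.mk_surjective _ z
    exact ⟨Submodule.Quotient.mk z, rfl⟩
  · intro z
    obtain ⟨z, rfl⟩ := Submodule.Quotient.mk_surjective _ z
    rw [Submodule.mapQ_apply, Submodule.Quotient.mk_eq_zero]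
    constructor
    · intro hz
      exact ⟨Submodule.Quotient.mk ⟨z, hz⟩, rfl⟩
    · rintro ⟨w, hw⟩
      obtain ⟨w, rfl⟩ := Submodule.Quotient.mk_surjective _ w
      rw [Submodule.mapQ_apply, Submodule.Quotient.eq] at hw
      have h1 : (w : E) - z ∈ C := hw
      have h2 : (z : E) = w - (w - z) := by abel
      change (z : E) ∈ B
      rw [h2]
      exact B.sub_mem w.2 (hCB h1)

/-- Additivity of length along `0 → (A ∩ ker f) / (B ∩ ker f) → A / B → f A / f B → 0`. -/
theorem relLength_eq_map_add_ker (f : E →ₗ[R] E') {A B : Submodule R E} (hBA : B ≤ A) :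
    relLength A B = relLength (A.map f) (B.map f) +
      relLength (A ⊓ LinearMap.ker f) (B ⊓ LinearMap.ker f) := by
  have hi : (B ⊓ LinearMap.ker f).submoduleOf (A ⊓ LinearMap.ker f) ≤
      (B.submoduleOf A).comap (Submodule.inclusion inf_le_left) := fun z hz => hz.1
  have hg : B.submoduleOf A ≤ ((B.map f).submoduleOf (A.map f)).comap (f.submoduleMap A) :=
    fun z hz => Submodule.mem_map_of_mem (f := f) hz
  rw [add_comm]
  refine Module.length_eq_add_of_exact (Submodule.mapQ _ _ _ hi) (Submodule.mapQ _ _ _ hg)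
    ?_ ?_ ?_
  · rw [injective_iff_map_eq_zero]
    intro z
    obtain ⟨z, rfl⟩ := Submodule.Quotient.mk_surjective _ z
    intro hz
    rw [Submodule.mapQ_apply, Submodule.Quotient.mk_eq_zero] at hz
    rw [Submodule.Quotient.mk_eq_zero]
    exact ⟨hz, z.2.2⟩
  · intro z
    obtain ⟨⟨_, a, ha, rfl⟩, rfl⟩ := Submodule.Quotient.mk_surjective _ z
    exact ⟨Submodule.Quotient.mk ⟨a, ha⟩, rfl⟩
  · intro z
    obtain ⟨z, rfl⟩ := Submodule.Quotient.mk_surjective _ z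
    rw [Submodule.mapQ_apply, Submodule.Quotient.mk_eq_zero]
    constructor
    · rintro ⟨b, hb, hbz⟩
      have hbz' : f b = f z := hbz
      refine ⟨Submodule.Quotient.mk ⟨z - b, A.sub_mem z.2 (hBA hb), ?_⟩, ?_⟩
      · change f (z - b) = 0
        rw [map_sub, hbz', sub_self]
      · rw [Submodule.mapQ_apply, Submodule.Quotient.eq]
        change (z : E) - b - z ∈ B
        simpa using hb
    · rintro ⟨w, hw⟩
      obtain ⟨w, rfl⟩ := Submodule.Quotient.mk_surjective _ w
      rw [Submodule.mapQ_apply, Submodule.Quotient.eq] at hw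
      refine ⟨z - w, ?_, ?_⟩
      · have h1 : (w : E) - z ∈ B := hw
        simpa using B.neg_mem h1
      · have h2 : f w = 0 := w.2.2
        rw [map_sub, h2, sub_zero]
        rfl

theorem relLength_map_of_injOn (f : E →ₗ[R] E') {A B : Submodule R E} (hBA : B ≤ A)
    (hf : A ⊓ LinearMap.ker f = ⊥) :
    relLength (A.map f) (B.map f) = relLength A B := by
  have : Subsingleton (↥(A ⊓ LinearMap.ker f) ⧸
      (B ⊓ LinearMap.ker f).submoduleOf (A ⊓ LinearMap.ker f)) := by
    rw [hf]
    infer_instance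
  have h0 : relLength (A ⊓ LinearMap.ker f) (B ⊓ LinearMap.ker f) = 0 := Module.length_eq_zero
  rw [relLength_eq_map_add_ker f hBA, h0, add_zero]

theorem relLength_self (A : Submodule R E) : relLength A A = 0 := by
  have : Subsingleton (A ⧸ A.submoduleOf A) :=
    Submodule.Quotient.subsingleton_iff.mpr (by simp)
  exact Module.length_eq_zero

theorem relLength_top_left (B : Submodule R E) : relLength ⊤ B = Module.length R (E ⧸ B) := by
  refine (Submodule.Quotient.equiv _ _ Submodule.topEquiv ?_).length_eq
  ext z
  simp [Submodule.submoduleOf]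

theorem relLength_top_prod (A : Submodule R E) (B : Submodule R E') :
    relLength ⊤ (A.prod B) = relLength ⊤ A + relLength ⊤ B := by
  have h := relLength_map_of_injOn (LinearMap.inl R E E') (le_top : A ≤ ⊤)
    (by rw [LinearMap.ker_eq_bot.mpr LinearMap.inl_injective, inf_bot_eq])
  have hsnd : (A.prod B).map (LinearMap.snd R E E') = B := by
    ext b
    simp only [Submodule.mem_map, Submodule.mem_prod, LinearMap.snd_apply, Prod.exists,
      exists_eq_right]
    exact ⟨fun ⟨_, hb⟩ => hb.2, fun hb => ⟨0, A.zero_mem, hb⟩⟩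
  have hker : (A.prod B) ⊓ LinearMap.ker (LinearMap.snd R E E') =
      A.map (LinearMap.inl R E E') := by
    ext ⟨a, b⟩
    simp only [Submodule.mem_inf, Submodule.mem_prod, LinearMap.mem_ker, LinearMap.snd_apply,
      Submodule.mem_map, LinearMap.inl_apply, Prod.mk.injEq]
    constructor
    · rintro ⟨⟨ha, -⟩, rfl⟩
      exact ⟨a, ha, rfl, rfl⟩
    · rintro ⟨a', ha, rfl, rfl⟩
      exact ⟨⟨ha, B.zero_mem⟩, rfl⟩
  have hker' : (⊤ : Submodule R (E × E')) ⊓ LinearMap.ker (LinearMap.snd R E E') =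
      (⊤ : Submodule R E).map (LinearMap.inl R E E') := by
    rw [top_inf_eq, Submodule.map_top, LinearMap.range_inl]
  rw [relLength_eq_map_add_ker (LinearMap.snd R E E') le_top, hsnd, hker, hker', h,
    Submodule.map_top, LinearMap.range_eq_top.mpr LinearMap.snd_surjective, add_comm]

end RelativeLength

/-! ### Functions with eventually constant second difference -/

section NumericalFunctions

theorem choose_two_sub (n : ℤ) : Ring.choose (n + 1) 2 - Ring.choose n 2 = n := by
  have h := Ring.choose_succ_succ n 1
  rw [Ring.choose_one_right] at h
  linarith

/-- Summing `E - Δ²h` telescopes to a first difference of `h`. -/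
theorem sub_eq_mul_sub_sum {h v : ℤ → ℤ} {E : ℤ} (h0 : ∀ n ≤ 0, h n = 0)
    (hv : ∀ n, v n = E - (h n - 2 * h (n - 1) + h (n - 2))) (n : ℕ) :
    h n - h (n - 1) = E * n - ∑ i ∈ Finset.range n, v (i + 1) := by
  induction n with
  | zero => simp [h0]
  | succ n ih =>
    rw [Finset.sum_range_succ, hv (n + 1)]
    have e1 : ((n : ℤ) + 1 - 1) = n := by ring
    have e2 : ((n : ℤ) + 1 - 2) = n - 1 := by ring
    push_cast
    rw [e1, e2]
    linarith

/-- A function on `ℤ` vanishing for `n ≤ 0` whose second difference is eventually the constant `E`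
is eventually a quadratic polynomial, with linear coefficient minus the sum of the defects
`E - Δ²h`. -/
theorem eventually_eq_quadratic {h v : ℤ → ℤ} {E : ℤ} (h0 : ∀ n ≤ 0, h n = 0)
    (hv : ∀ n, v n = E - (h n - 2 * h (n - 1) + h (n - 2))) {N : ℕ}
    (hN : ∀ n : ℤ, N ≤ n → v n = 0) :
    ∃ c, ∀ n : ℤ, N ≤ n → h n = E * Ring.choose (n + 1) 2 -
      (∑ i ∈ Finset.range N, v (i + 1)) * n + c := by
  refine ⟨h N - E * Ring.choose ((N : ℤ) + 1) 2 + (∑ i ∈ Finset.range N, v (i + 1)) * N, ?_⟩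
  intro n hn
  induction n, hn using Int.leInduction with
  | base => ring
  | succ n hn ih =>
    have h1 := sub_eq_mul_sub_sum h0 hv (n + 1).toNat
    have h2 : ∑ i ∈ Finset.range (n + 1).toNat, v (i + 1) = ∑ i ∈ Finset.range N, v (i + 1) := by
      symm
      refine Finset.sum_subset (Finset.range_subset_range.mpr (by omega)) fun i _ hi => hN _ ?_
      have : N ≤ i := by simpa using hi
      omega
    have h3 : (((n + 1).toNat : ℕ) : ℤ) = n + 1 := by omega
    rw [h2, h3, add_sub_cancel_right] at h1
    have h4 := choose_two_sub (n + 1)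
    linear_combination h1 + ih - E * h4

/-- The linear coefficient of a quadratic polynomial, in the basis `n(n + 1) / 2, n, 1`, is determined
by its values at large `n`. -/
theorem linear_coeff_unique {h : ℤ → ℤ} {a b c a' b' c' : ℤ}
    (h1 : ∀ᶠ n : ℤ in atTop, h n = a * Ring.choose (n + 1) 2 - b * n + c)
    (h2 : ∀ᶠ n : ℤ in atTop, h n = a' * Ring.choose (n + 1) 2 - b' * n + c') : b = b' := by
  obtain ⟨N, hN⟩ := eventually_atTop.mp (h1.and h2)
  have e0 := hN N le_rfl
  have e1 := hN (N + 1) (by omega)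
  have e2 := hN (N + 2) (by omega)
  have c1 := choose_two_sub (N + 1)
  have c2 := choose_two_sub (N + 2)
  have e3 : N + 1 + 1 = N + 2 := by ring
  rw [e3] at c1 e1
  have d0 := e0.1.symm.trans e0.2
  have d1 := e1.1.symm.trans e1.2
  have d2 := e2.1.symm.trans e2.2
  have ha : a = a' := by
    linear_combination d2 - 2 * d1 + d0 - (a - a') * (c2 - c1)
  subst ha
  linear_combination d0 - d1

end NumericalFunctions

/-! ### Finite length and the ideals of an admissible filtration -/

section FiniteLength

theorem length_quotient_ne_top_of_pow_le {R : Type*} [CommRing R] [IsLocalRing R]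
    [IsNoetherianRing R] {I K : Ideal R} (hI : I.radical = IsLocalRing.maximalIdeal R) {n : ℕ}
    (hK : I ^ n ≤ K) : Module.length R (R ⧸ K) ≠ ⊤ := by
  by_cases htop : K = ⊤
  · subst htop
    rw [Module.length_eq_zero]
    exact ENat.zero_ne_top
  have hmin : IsLocalRing.maximalIdeal R ∈ K.minimalPrimes := by
    refine ⟨⟨inferInstance, IsLocalRing.le_maximalIdeal htop⟩, fun p hp _ => ?_⟩
    rw [← hI]
    exact hp.1.radical_le_iff.mpr (hp.1.le_of_pow_le (hK.trans hp.2))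
  have := IsLocalRing.quotient_artinian_of_mem_minimalPrimes_of_isLocalRing K hmin
  have : IsArtinian R (R ⧸ K) :=
    isArtinian_of_surjective_algebraMap (Ideal.Quotient.mk_surjective (I := K))
  exact Module.length_ne_top

end FiniteLength

namespace AdmissibleFiltration

section General

variable {R : Type*} [CommRing R] {I : Ideal R} (F : AdmissibleFiltration I)

theorem obj_antitone : Antitone F.obj :=
  antitone_int_of_succ_le F.succ_le

theorem obj_eq_top {n : ℤ} (hn : n ≤ 0) : F.obj n = ⊤ :=
  top_le_iff.mp (F.obj_zero ▸ F.obj_antitone hn)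

theorem mul_obj_le (n : ℤ) : I * F.obj n ≤ F.obj (n + 1) := by
  rw [add_comm]
  exact (Ideal.mul_mono_left F.le_obj_one).trans (F.mul_le 1 n)

theorem mul_obj_sub_one_le (n : ℤ) : I * F.obj (n - 1) ≤ F.obj n := by
  simpa using F.mul_obj_le (n - 1)

/-- The Rees module of the filtration sits inside that of the shifted `I`-adic filtration, which
is finitely generated over the Noetherian Rees algebra of `I`. -/
theorem exists_mul_obj_eq [IsNoetherianRing R] :
    ∃ N : ℕ, ∀ n : ℤ, N ≤ n → I * F.obj (n - 1) = F.obj n := by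
  obtain ⟨k, hk⟩ := F.admissible
  let A : I.Filtration R :=
    { N := fun i => I ^ (i - k)
      mono := fun i => Ideal.pow_le_pow_right (by omega)
      smul_le := fun i => by
        rw [smul_eq_mul, ← pow_succ']
        exact Ideal.pow_le_pow_right (by omega) }
  let B : I.Filtration R :=
    { N := fun i => F.obj i
      mono := fun i => F.obj_antitone (by omega)
      smul_le := fun i => F.mul_obj_le i }
  have hA : A.Stable := by
    refine ⟨k, fun n hn => ?_⟩
    change I • I ^ (n - k) = I ^ (n + 1 - k)
    rw [smul_eq_mul, ← pow_succ', show n - k + 1 = n + 1 - k by omega]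
  have hBA : B ≤ A := fun i => by
    change F.obj i ≤ I ^ (i - k)
    rw [show i - k = ((i : ℤ) - k).toNat by omega]
    exact (hk i).2
  obtain ⟨N, hN⟩ := hA.of_le hBA
  refine ⟨N + 1, fun n hn => ?_⟩
  have h : I • F.obj ((n - 1).toNat : ℕ) = F.obj ((n - 1).toNat + 1 : ℕ) :=
    hN (n - 1).toNat (by omega)
  rwa [show (((n - 1).toNat : ℕ) : ℤ) = n - 1 by omega,
    show (((n - 1).toNat + 1 : ℕ) : ℤ) = n by omega] at h

/-- A form of the Artin–Rees lemma. -/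
theorem exists_inf_obj_le_mul [IsNoetherianRing R] (C : Ideal R) :
    ∃ N : ℕ, ∀ n : ℤ, N ≤ n → C ⊓ F.obj n ≤ I * C := by
  obtain ⟨k, hk⟩ := F.admissible
  obtain ⟨c, hc⟩ := I.exists_pow_inf_eq_pow_smul C
  refine ⟨k + c + 1, fun n hn => ?_⟩
  have h1 : F.obj n ≤ I ^ (c + 1) :=
    (hk n).2.trans (Ideal.pow_le_pow_right (by omega))
  have h2 := hc (c + 1) (by omega)
  rw [Nat.add_sub_cancel_left, pow_one, smul_eq_mul, smul_eq_mul, Ideal.mul_top] at h2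
  rw [inf_comm]
  refine (inf_le_inf_right C h1).trans (h2.le.trans ?_)
  exact Ideal.mul_mono_right inf_le_right

theorem eq_zero_of_forall_mem_obj [IsNoetherianRing R] [IsLocalRing R] (hI : I ≠ ⊤) {a : R}
    (ha : ∀ n : ℕ, a ∈ F.obj n) : a = 0 := by
  obtain ⟨k, hk⟩ := F.admissible
  have h : a ∈ ⨅ i : ℕ, I ^ i := by
    rw [Ideal.mem_iInf]
    intro i
    have h1 := (hk ((i + k : ℕ) : ℤ)).2 (ha (i + k))
    rwa [show (((i + k : ℕ) : ℤ) - k).toNat = i by omega] at h1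
  rwa [Ideal.iInf_pow_eq_bot_of_isLocalRing I hI] at h

/-- If the initial form of `x` in degree one is regular on the associated graded ring, then
`(I_{n+1} : x) = I_n` for all `n`. -/
theorem mem_obj_of_mul_mem {x : R} (hxI : x ∈ F.obj 1)
    (hx : F.gradedClass 1 ⟨x, hxI⟩ ∈ nonZeroDivisors F.assocGraded) {a : R} {n : ℤ}
    (h : x * a ∈ F.obj (n + 1)) : a ∈ F.obj n := by
  have step (m : ℕ) (ha : a ∈ F.obj m) (hm : x * a ∈ F.obj (m + 2)) : a ∈ F.obj (m + 1) := by
    have h0 : F.gradedClass 1 ⟨x, hxI⟩ * F.gradedClass m ⟨a, ha⟩ = 0 := by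
      rw [gradedClass, gradedClass, ← map_mul, reesToGraded_eq_zero_iff]
      intro i
      change (monomial 1 x * monomial m a : R[X]).coeff i ∈ _
      rw [monomial_mul_monomial, coeff_monomial]
      split_ifs with hi
      · subst hi
        convert hm using 2
        push_cast
        ring
      · exact Ideal.zero_mem _
    have h1 : F.gradedClass m ⟨a, ha⟩ = 0 := (mem_nonZeroDivisors_iff.mp hx).1 _ h0
    rw [gradedClass, reesToGraded_eq_zero_iff] at h1
    have h2 := h1 m
    change (monomial m a : R[X]).coeff m ∈ _ at h2
    rwa [coeff_monomial_same] at h2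
  -- `x a ∈ I_{n+1}` pushes `a` one step deeper into the filtration, as long as the degree is
  -- below `n`; the associated graded ring sees only nonnegative degrees.
  have key : ∀ m : ℕ, (m : ℤ) ≤ n → a ∈ F.obj m := by
    intro m
    induction m with
    | zero =>
      intro _
      rw [F.obj_eq_top (by simp)]
      trivial
    | succ m ih =>
      intro hm
      push_cast at hm ⊢
      exact step m (ih (by omega)) (F.obj_antitone (by omega) h)
  rcases le_or_gt n 0 with hn | hn
  · rw [F.obj_eq_top hn]
    trivial
  · have := key n.toNat (by omega)
    rwa [Int.toNat_of_nonneg hn.le] at this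

theorem eq_zero_of_mul_eq_zero [IsNoetherianRing R] [IsLocalRing R] (hI : I ≠ ⊤) {x : R}
    (hxI : x ∈ F.obj 1)
    (hx : F.gradedClass 1 ⟨x, hxI⟩ ∈ nonZeroDivisors F.assocGraded) {a : R}
    (h : x * a = 0) : a = 0 :=
  F.eq_zero_of_forall_mem_obj hI fun _ =>
    F.mem_obj_of_mul_mem hxI hx (h ▸ Ideal.zero_mem _)

end General

end AdmissibleFiltration

/-! ### The truncated Koszul complex -/

namespace AdmissibleFiltration

section Koszul

variable {R : Type*} [CommRing R] {x y : R} (F : AdmissibleFiltration (Ideal.span {x, y}))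

theorem mem_colon_span_singleton {a : R} :
    a ∈ (Ideal.span {x}).colon {y} ↔ ∃ c, x * c = a * y := by
  rw [Submodule.mem_colon_singleton, smul_eq_mul, Ideal.mem_span_singleton']
  simp only [mul_comm x]

theorem span_singleton_eq_map (K : Ideal R) :
    Ideal.span {x} * K = Submodule.map (LinearMap.mulLeft R x) K := by
  ext a
  rw [Ideal.mem_span_singleton_mul]
  rfl

/-- The Koszul map `(a, b) ↦ x a + y b`. -/
noncomputable def koszulMap (x y : R) : R × R →ₗ[R] R :=
  (LinearMap.mulLeft R x).coprod (LinearMap.mulLeft R y)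

theorem map_koszulMap_prod (K : Ideal R) :
    Submodule.map (koszulMap x y) (Submodule.prod K K) = Ideal.span {x, y} * K := by
  rw [Ideal.span_insert, Ideal.sup_mul, span_singleton_eq_map, span_singleton_eq_map, koszulMap,
    LinearMap.map_coprod_prod]

theorem map_koszulMap_top :
    Submodule.map (koszulMap x y) ⊤ = Ideal.span {x, y} := by
  have := map_koszulMap_prod (x := x) (y := y) ⊤
  rwa [Submodule.prod_top, Ideal.mul_top] at this

/-- The second coordinates of the syzygies of `(x, y)` form `(x : y)`; when `x` is regular, a syzygy
is determined by its second coordinate. -/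
theorem map_snd_ker_koszulMap :
    Submodule.map (LinearMap.snd R R R) (LinearMap.ker (koszulMap x y)) =
      (Ideal.span {x}).colon {y} := by
  ext b
  rw [mem_colon_span_singleton]
  constructor
  · rintro ⟨⟨a, b⟩, h, rfl⟩
    have h' : x * a + y * b = 0 := h
    exact ⟨-a, by change x * -a = b * y; linear_combination -h'⟩
  · rintro ⟨c, hc⟩
    refine ⟨(-c, b), ?_, rfl⟩
    change x * -c + y * b = 0
    linear_combination -hc

/-- The hypotheses hold for `K = J_{n-1}` and `L = J_n`: the first coordinate of a syzygy whose
second coordinate is in `K` is then automatically in `K`. -/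
theorem map_snd_prod_inf_ker_koszulMap {K L : Ideal R} (hyK : Ideal.span {y} * K ≤ L)
    (hxL : ∀ a, x * a ∈ L → a ∈ K) :
    Submodule.map (LinearMap.snd R R R)
        (Submodule.prod K K ⊓ LinearMap.ker (koszulMap x y)) =
      (Ideal.span {x}).colon {y} ⊓ K := by
  ext b
  rw [Submodule.mem_inf, mem_colon_span_singleton]
  constructor
  · rintro ⟨⟨a, b⟩, ⟨hab, h⟩, rfl⟩
    have h' : x * a + y * b = 0 := h
    exact ⟨⟨-a, by change x * -a = b * y; linear_combination -h'⟩, hab.2⟩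
  · rintro ⟨⟨c, hc⟩, hb⟩
    refine ⟨(-c, b), ⟨⟨K.neg_mem (hxL c ?_), hb⟩, ?_⟩, rfl⟩
    · rw [hc, mul_comm]
      exact hyK (Ideal.mul_mem_mul (Ideal.mem_span_singleton_self y) hb)
    · change x * -c + y * b = 0
      linear_combination -hc

/-- Truncated Koszul complex: `(R/K)² → J/JK` is surjective with kernel `(x : y)/((x : y) ∩ K)`. -/
theorem relLength_top_add_self {K L : Ideal R} (hx0 : ∀ a, x * a = 0 → a = 0)
    (hyK : Ideal.span {y} * K ≤ L) (hxL : ∀ a, x * a ∈ L → a ∈ K) :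
    relLength ⊤ K + relLength ⊤ K =
      relLength (Ideal.span {x, y}) (Ideal.span {x, y} * K) +
        relLength ((Ideal.span {x}).colon {y}) ((Ideal.span {x}).colon {y} ⊓ K) := by
  have hinj : LinearMap.ker (koszulMap x y) ⊓ LinearMap.ker (LinearMap.snd R R R) = ⊥ := by
    rw [eq_bot_iff]
    rintro ⟨a, b⟩ ⟨h, hb⟩
    have h' : x * a + y * b = 0 := h
    have hb' : b = 0 := hb
    subst hb'
    rw [mul_zero, add_zero] at h'
    rw [hx0 a h']
    exact Submodule.zero_mem _
  rw [← relLength_top_prod, relLength_eq_map_add_ker (koszulMap x y) le_top,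
    map_koszulMap_top, map_koszulMap_prod, top_inf_eq,
    ← relLength_map_of_injOn _ inf_le_right hinj, map_snd_ker_koszulMap,
    map_snd_prod_inf_ker_koszulMap hyK hxL]

theorem relLength_span_singleton (hx0 : ∀ a, x * a = 0 → a = 0) (K : Ideal R) :
    relLength (Ideal.span {x}) (Ideal.span {x} * K) = relLength ⊤ K := by
  rw [← relLength_map_of_injOn (LinearMap.mulLeft R x) le_top ?_, ← span_singleton_eq_map,
    ← span_singleton_eq_map, Ideal.mul_top]
  rw [top_inf_eq, eq_bot_iff]
  exact fun a ha => hx0 a ha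

theorem hilbertFunction_eq (n : ℤ) : F.hilbertFunction n = relLength ⊤ (F.obj n) :=
  (relLength_top_left _).symm

theorem span_singleton_le_colon (x y : R) : Ideal.span {x} ≤ (Ideal.span {x}).colon {y} := by
  intro a ha
  rw [Submodule.mem_colon_singleton]
  exact Ideal.mul_mem_right _ _ ha

theorem span_mul_colon_le (x y : R) :
    Ideal.span {x, y} * (Ideal.span {x}).colon {y} ≤ Ideal.span {x} := by
  rw [Ideal.span_insert, Ideal.sup_mul, sup_le_iff]
  refine ⟨Ideal.mul_le_left, ?_⟩
  rw [Ideal.span_singleton_mul_le_iff]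
  intro z hz
  rw [Submodule.mem_colon_singleton] at hz
  rwa [mul_comm]

theorem hilbertFunction_ne_top [IsLocalRing R] [IsNoetherianRing R]
    (hJ : (Ideal.span {x, y}).radical = IsLocalRing.maximalIdeal R) (n : ℤ) :
    F.hilbertFunction n ≠ ⊤ := by
  obtain ⟨k, hk⟩ := F.admissible
  exact length_quotient_ne_top_of_pow_le hJ (hk n).1

theorem span_ne_top [IsLocalRing R]
    (hJ : (Ideal.span {x, y}).radical = IsLocalRing.maximalIdeal R) :
    Ideal.span {x, y} ≠ ⊤ := by
  intro h
  rw [h, Ideal.radical_top] at hJ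
  exact (IsLocalRing.maximalIdeal.isMaximal R).ne_top hJ.symm

/-- By Artin–Rees, `(x : y) ∩ J_n ⊆ (x)` for large `n`, so `(x : y) / (x)` is a quotient of
`(x : y) / ((x : y) ∩ J_n)`, which embeds in `(R / J_n)²` as a Koszul kernel. -/
theorem relLength_colon_ne_top [IsLocalRing R] [IsNoetherianRing R]
    (hJ : (Ideal.span {x, y}).radical = IsLocalRing.maximalIdeal R)
    (hx0 : ∀ a, x * a = 0 → a = 0)
    (hxJ : ∀ (n : ℤ) a, x * a ∈ F.obj (n + 1) → a ∈ F.obj n) :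
    relLength ((Ideal.span {x}).colon {y}) (Ideal.span {x}) ≠ ⊤ := by
  obtain ⟨N, hN⟩ := F.exists_inf_obj_le_mul ((Ideal.span {x}).colon {y})
  have hle := (hN N le_rfl).trans (span_mul_colon_le x y)
  have h1 := relLength_add (span_singleton_le_colon x y) hle
  have h2 := relLength_top_add_self hx0
    ((Ideal.mul_mono_left (Ideal.span_mono (Set.subset_insert x {y}))).trans (F.mul_obj_le N))
    (hxJ N)
  have h3 := F.hilbertFunction_ne_top hJ N
  rw [hilbertFunction_eq] at h3
  have h4 : relLength ⊤ (F.obj N) + relLength ⊤ (F.obj N) ≠ ⊤ := WithTop.add_ne_top.mpr ⟨h3, h3⟩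
  rw [h2] at h4
  have h5 := (WithTop.add_ne_top.mp h4).2
  rw [← h1] at h5
  exact (WithTop.add_ne_top.mp h5).1

/-- The `n`-th term of the series is `E - (H(n) - 2 H(n - 1) + H(n - 2))`, where `H` is the Hilbert
function and `E = λ(R / J) - λ((x : y) / (x))` does not depend on `n`. It is a
variant of Huneke's fundamental lemma in which the correction term `(x : y)` replaces the
assumption that `x, y` is a regular sequence. -/
theorem exists_huneke_identity [IsLocalRing R] [IsNoetherianRing R]
    (hJ : (Ideal.span {x, y}).radical = IsLocalRing.maximalIdeal R)
    (hx0 : ∀ a, x * a = 0 → a = 0)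
    (hxJ : ∀ (n : ℤ) a, x * a ∈ F.obj (n + 1) → a ∈ F.obj n) :
    ∃ E : ℤ, ∀ n : ℤ,
      quotLength (F.obj n) (Ideal.span {x, y} * F.obj (n - 1)) ≠ ⊤ ∧
      quotLength ((Ideal.span {x}).colon {y} ⊓ F.obj (n - 1))
        (Ideal.span {x} * F.obj (n - 2)) ≠ ⊤ ∧
      ((quotLength (F.obj n) (Ideal.span {x, y} * F.obj (n - 1))).toNat : ℤ) -
        ((quotLength ((Ideal.span {x}).colon {y} ⊓ F.obj (n - 1))
          (Ideal.span {x} * F.obj (n - 2))).toNat : ℤ) =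
      E - ((F.hilbertFunction n).toNat - 2 * (F.hilbertFunction (n - 1)).toNat +
        (F.hilbertFunction (n - 2)).toNat) := by
  refine ⟨(relLength ⊤ (Ideal.span {x, y})).toNat -
    (relLength ((Ideal.span {x}).colon {y}) (Ideal.span {x})).toNat, fun n => ?_⟩
  change relLength _ _ ≠ ⊤ ∧ relLength _ _ ≠ ⊤ ∧
    ((relLength _ _).toNat : ℤ) - ((relLength _ _).toNat : ℤ) = _
  have hxle : Ideal.span {x} ≤ Ideal.span {x, y} := Ideal.span_mono (by simp)
  have hyle : Ideal.span {y} ≤ Ideal.span {x, y} := Ideal.span_mono (by simp)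
  have hsub : F.obj (n - 1) = F.obj (n - 2 + 1) := by ring_nf
  have hxmul : Ideal.span {x} * F.obj (n - 2) ≤
      (Ideal.span {x}).colon {y} ⊓ F.obj (n - 1) := by
    refine le_inf (Ideal.mul_le_left.trans (span_singleton_le_colon x y)) ?_
    rw [hsub]
    exact (Ideal.mul_mono_left hxle).trans (F.mul_obj_le _)
  have e1 := relLength_add (le_top : F.obj n ≤ ⊤) (F.mul_obj_sub_one_le n)
  have e2 := relLength_add (le_top : Ideal.span {x, y} ≤ ⊤)
    (Ideal.mul_le_left : Ideal.span {x, y} * F.obj (n - 1) ≤ _)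
  have e3 := relLength_top_add_self hx0
    ((Ideal.mul_mono_left hyle).trans (F.mul_obj_sub_one_le n))
    (fun a ha => hxJ (n - 1) a (by rwa [sub_add_cancel]))
  have e4 := relLength_add (span_singleton_le_colon x y)
    (Ideal.mul_le_left : Ideal.span {x} * F.obj (n - 2) ≤ _)
  have e5 := relLength_add inf_le_left hxmul
  have e6 := relLength_span_singleton hx0 (F.obj (n - 2))
  have f0 := F.hilbertFunction_ne_top hJ n
  have f1 := F.hilbertFunction_ne_top hJ (n - 1)
  have f2 := F.hilbertFunction_ne_top hJ (n - 2)
  have fJ : relLength ⊤ (Ideal.span {x, y}) ≠ ⊤ := by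
    rw [relLength_top_left]
    exact length_quotient_ne_top_of_pow_le hJ (pow_one _).le
  have fC := F.relLength_colon_ne_top hJ hx0 hxJ
  simp only [hilbertFunction_eq] at f0 f1 f2 ⊢
  rw [e6] at e4
  have g3 := WithTop.add_ne_top.mp (e3 ▸ WithTop.add_ne_top.mpr ⟨f1, f1⟩)
  have g4 := WithTop.add_ne_top.mp ((e4.trans e5.symm) ▸ WithTop.add_ne_top.mpr ⟨fC, f2⟩)
  have g1 := WithTop.add_ne_top.mp ((e2.trans e1.symm) ▸ WithTop.add_ne_top.mpr ⟨fJ, g3.1⟩)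
  refine ⟨g1.2, g4.2, ?_⟩
  -- The two chains from `R` to `J J_{n-1}`, the Koszul kernel count, and the two chains from
  -- `(x : y)` to `x J_{n-2}`, now as identities of natural numbers.
  have E1 := congrArg ENat.toNat (e2.trans e1.symm)
  have E2 := congrArg ENat.toNat e3
  have E3 := congrArg ENat.toNat (e4.trans e5.symm)
  rw [ENat.toNat_add fJ g3.1, ENat.toNat_add f0 g1.2] at E1
  rw [ENat.toNat_add f1 f1, ENat.toNat_add g3.1 g3.2] at E2
  rw [ENat.toNat_add fC f2, ENat.toNat_add g4.1 g4.2] at E3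
  omega

/-- The terms of the series vanish for large `n`: then `J_n = J J_{n-1}`, and
`(x : y) ∩ J_{n-1} ⊆ (x) ∩ J_{n-1} = x J_{n-2}`. -/
theorem exists_quotLength_eq_zero [IsNoetherianRing R]
    (hxJ : ∀ (n : ℤ) a, x * a ∈ F.obj (n + 1) → a ∈ F.obj n) :
    ∃ N : ℕ, ∀ n : ℤ, N ≤ n →
      quotLength (F.obj n) (Ideal.span {x, y} * F.obj (n - 1)) = 0 ∧
      quotLength ((Ideal.span {x}).colon {y} ⊓ F.obj (n - 1))
        (Ideal.span {x} * F.obj (n - 2)) = 0 := by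
  obtain ⟨N, hN⟩ := F.exists_mul_obj_eq
  obtain ⟨M, hM⟩ := F.exists_inf_obj_le_mul ((Ideal.span {x}).colon {y})
  refine ⟨N + M + 1, fun n hn => ?_⟩
  have hle : (Ideal.span {x}).colon {y} ⊓ F.obj (n - 1) ≤ Ideal.span {x} * F.obj (n - 2) := by
    intro b hb
    have hbx := span_mul_colon_le x y (hM (n - 1) (by omega) hb)
    obtain ⟨c, rfl⟩ := Ideal.mem_span_singleton.mp hbx
    refine Ideal.mul_mem_mul (Ideal.mem_span_singleton_self x) (hxJ _ c ?_)
    rw [show n - 2 + 1 = n - 1 by ring]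
    exact hb.2
  have hge : Ideal.span {x} * F.obj (n - 2) ≤ (Ideal.span {x}).colon {y} ⊓ F.obj (n - 1) := by
    refine le_inf (Ideal.mul_le_left.trans (span_singleton_le_colon x y)) ?_
    rw [show n - 1 = n - 2 + 1 by ring]
    exact (Ideal.mul_mono_left (Ideal.span_mono (by simp))).trans (F.mul_obj_le _)
  rw [hN n (by omega), le_antisymm hle hge]
  exact ⟨relLength_self _, relLength_self _⟩

end Koszul

/-! ### Hilbert coefficients -/

section HilbertCoefficients

variable {R : Type*} [CommRing R] {I : Ideal R} (F : AdmissibleFiltration I)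

/-- In dimension two, with finite lengths, the defining sum written out. The finiteness hypothesis
is needed because `toNat` sends `⊤` to `0`. -/
theorem isHilbertCoeffs_two_iff (hfin : ∀ n, F.hilbertFunction n ≠ ⊤) (e : Fin 3 → ℤ) :
    F.IsHilbertCoeffs 2 e ↔ ∀ᶠ n : ℤ in atTop,
      ((F.hilbertFunction n).toNat : ℤ) = e 0 * Ring.choose (n + 1) 2 - e 1 * n + e 2 := by
  refine eventually_congr (Eventually.of_forall fun n => ?_)
  have hsum : ∑ i : Fin (2 + 1), (-1) ^ (i : ℕ) * e i *
      Ring.choose (n + (2 : ℕ) - 1 - (i : ℕ)) (2 - (i : ℕ)) =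
      e 0 * Ring.choose (n + 1) 2 - e 1 * n + e 2 := by
    rw [Fin.sum_univ_three]
    simp only [Fin.val_zero, Fin.val_one, Fin.val_two, Nat.sub_zero, Nat.sub_self,
      Ring.choose_zero_right, show 2 - 1 = 1 from rfl, Ring.choose_one_right]
    push_cast
    rw [show n + 2 - 1 - 0 = n + 1 by ring]
    ring
  rw [hsum]
  constructor
  · rintro ⟨l, hl, hl'⟩
    rw [hl, ← hl']
    rfl
  · intro h
    exact ⟨_, (ENat.natCast_toNat (hfin n)).symm, h⟩

theorem isHilbertCoeffs_hilbertCoeffs {d : ℕ} (h : ∃ e, F.IsHilbertCoeffs d e) :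
    F.IsHilbertCoeffs d (F.hilbertCoeffs d) := by
  rw [hilbertCoeffs, dif_pos h]
  exact h.choose_spec

end HilbertCoefficients

end AdmissibleFiltration

/-- Here `J = (x, y)` is a parameter ideal of the two-dimensional local ring `R`, `F` is a
`J`-admissible filtration `(J_n)`, and `x* ∈ J_1 / J_2` is a nonzerodivisor in the associated graded
ring. The Hilbert coefficients `e_0, e_1, e_2` of `F` exist, all lengths in the formula are finite,
and the series of integers converges (only finitely many terms are nonzero) to `e_1`. -/
theorem theorem3p2 {R : Type*} [CommRing R] [IsLocalRing R] [IsNoetherianRing R]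
    (hdim : ringKrullDim R = 2) (x y : R)
    (hJ : (Ideal.span {x, y}).radical = IsLocalRing.maximalIdeal R)
    (F : AdmissibleFiltration (Ideal.span {x, y}))
    (hx : F.gradedClass 1 ⟨x, F.le_obj_one (Ideal.subset_span (Set.mem_insert x {y}))⟩ ∈
      nonZeroDivisors F.assocGraded) :
    F.IsHilbertCoeffs 2 (F.hilbertCoeffs 2) ∧
    (∀ n : ℕ+,
      quotLength (F.obj n) (Ideal.span {x, y} * F.obj (n - 1)) ≠ ⊤ ∧
      quotLength ((Ideal.span {x}).colon {y} ⊓ F.obj (n - 1))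
        (Ideal.span {x} * F.obj (n - 2)) ≠ ⊤) ∧
    HasSum
      (fun n : ℕ+ =>
        ((quotLength (F.obj n) (Ideal.span {x, y} * F.obj (n - 1))).toNat : ℤ) -
        ((quotLength ((Ideal.span {x}).colon {y} ⊓ F.obj (n - 1))
          (Ideal.span {x} * F.obj (n - 2))).toNat : ℤ))
      (F.hilbertCoeffs 2 1) := by
  have hJtop := AdmissibleFiltration.span_ne_top hJ
  have hx0 : ∀ a, x * a = 0 → a = 0 := fun a => F.eq_zero_of_mul_eq_zero hJtop _ hx
  have hxJ : ∀ (n : ℤ) a, x * a ∈ F.obj (n + 1) → a ∈ F.obj n :=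
    fun n a => F.mem_obj_of_mul_mem _ hx
  obtain ⟨E, hE⟩ := F.exists_huneke_identity hJ hx0 hxJ
  obtain ⟨N, hN⟩ := F.exists_quotLength_eq_zero hxJ
  have hfin := F.hilbertFunction_ne_top hJ
  set h : ℤ → ℤ := fun n => (F.hilbertFunction n).toNat with h_def
  set v : ℤ → ℤ := fun n =>
    ((quotLength (F.obj n) (Ideal.span {x, y} * F.obj (n - 1))).toNat : ℤ) -
      ((quotLength ((Ideal.span {x}).colon {y} ⊓ F.obj (n - 1))
        (Ideal.span {x} * F.obj (n - 2))).toNat : ℤ) with v_def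
  have h0 : ∀ n ≤ 0, h n = 0 := by
    intro n hn
    have : Subsingleton (R ⧸ F.obj n) := Ideal.Quotient.subsingleton_iff.mpr (F.obj_eq_top hn)
    simp [h_def, AdmissibleFiltration.hilbertFunction]
  have hv : ∀ n, v n = E - (h n - 2 * h (n - 1) + h (n - 2)) := fun n => (hE n).2.2
  have hvN : ∀ n : ℤ, N ≤ n → v n = 0 := by
    intro n hn
    simp [v_def, (hN n hn).1, (hN n hn).2]
  obtain ⟨c, hc⟩ := eventually_eq_quadratic h0 hv hvN
  have hquad := eventually_atTop.mpr ⟨(N : ℤ), hc⟩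
  have hcoeff : F.IsHilbertCoeffs 2 (F.hilbertCoeffs 2) :=
    F.isHilbertCoeffs_hilbertCoeffs
      ⟨![E, ∑ i ∈ Finset.range N, v (i + 1), c], (F.isHilbertCoeffs_two_iff hfin _).mpr hquad⟩
  have he1 : F.hilbertCoeffs 2 1 = ∑ i ∈ Finset.range N, v (i + 1) :=
    linear_coeff_unique ((F.isHilbertCoeffs_two_iff hfin _).mp hcoeff) hquad
  refine ⟨hcoeff, fun n => ⟨(hE n).1, (hE n).2.1⟩, ?_⟩
  rw [he1, ← Equiv.pnatEquivNat.symm.hasSum_iff]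
  have hsum : HasSum (fun i : ℕ => v (i + 1)) (∑ i ∈ Finset.range N, v (i + 1)) := by
    refine hasSum_sum_of_ne_finset_zero fun i hi => hvN _ ?_
    have : N ≤ i := by simpa using hi
    omega
  convert hsum using 2 with i
  simp [v_def]
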